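/- Let $\mathbb T=\mathbb R/2\pi\mathbb Z$ with Lebesgue measure $|\cdot|$ (so $|\mathbb T|=2\pi$). For $\Lambda\subset\mathbb Z$ and $S\subset\mathbb T$ let $E(\Lambda)=\{e^{i\lambda x}\}_{\lambda\in\Lambda}$, regarded as a system in $L^2(S)$. A system $\{\varphi_i\}_{i\in I}$ in a Hilbert space is a Riesz sequence if there are constants $0<A\le B$ with $A\sum|a_i|^2\le\|\sum a_i\varphi_i\|^2\le B\sum|a_i|^2$ for all finite sequences of scalars $(a_i)$. A set $\Lambda=\{\dots<\lambda_0<\lambda_1<\dots\}\subset\mathbb Z$ is syndetic if its consecutive gaps $\lambda_{j+1}-\lambda_j$, $j\in\mathbb Z$, are bounded. A simple quasicrystal is a set $\{n\in\mathbb Z:\{\alpha n\}\in[a,b)\}$ with $\alpha$ irrational and $0\le a<b\le1$, where $\{x\}$ is the fractional part of $x$. Theorem. There exist universal constants $C,c>0$ such that the following holds for every nonempty open set $S\subset\mathbb T$. (1) There are an integer $d\ge2$ with $d\le C/|S|$ and a syndetic simple quasicrystal $\Lambda\subset\mathbb Z$ such that the set of gaps between consecutive elements of $\Lambda$ is exactly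 $\{1,d\}$ and $E(\Lambda)$ is a Riesz sequence in $L^2(S)$. (2) If moreover $|S|/2\pi>1/2$, then there are an integer $d\ge 2$ with $d\le C/|S|$ and a syndetic set $\Lambda\subset\mathbb Z$ such that the set of gaps between consecutive elements of $\Lambda$ is exactly $\{1,d\}$, $E(\Lambda)$ is a Riesz sequence in $L^2(S)$, and $\Lambda^c=\mathbb Z\setminus\Lambda$ is uniformly separated with $$\inf_{\lambda,\mu\in\Lambda^c,\ \lambda\ne\mu}|\lambda-\mu|\ \ge\ \frac{c}{|S^c|}.$$ If $|S^c|>0$, this $\Lambda$ can also be taken to be a simple quasicrystal. If $|S^c|=0$, the right-hand side is read as $+\infty$, so the bound says that $\Lambda^c$ has at most one element (the infimum over the empty set being $+\infty$). -/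

import Mathlib

open MeasureTheory

/-- A system of vectors `φ` in an inner product space is a Riesz sequence if there are constants
`0 < A ≤ B` with `A ∑ |aᵢ|² ≤ ‖∑ aᵢ φᵢ‖² ≤ B ∑ |aᵢ|²` for all finite sequences of scalars. -/
def IsRieszSequence {ι H : Type*} [NormedAddCommGroup H] [InnerProductSpace ℂ H]
    (φ : ι → H) : Prop :=
  ∃ A B : ℝ, 0 < A ∧ A ≤ B ∧ ∀ (s : Finset ι) (a : ι → ℂ),
    A * ∑ i ∈ s, ‖a i‖ ^ 2 ≤ ‖∑ i ∈ s, a i • φ i‖ ^ 2 ∧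
      ‖∑ i ∈ s, a i • φ i‖ ^ 2 ≤ B * ∑ i ∈ s, ‖a i‖ ^ 2

/-- The torus `𝕋 = ℝ / 2πℤ`. Its `volume` is Lebesgue measure, of total mass `2π`. -/
abbrev Torus : Type := AddCircle (2 * Real.pi)

instance fact_two_pi_pos : Fact ((0 : ℝ) < 2 * Real.pi) := ⟨Real.two_pi_pos⟩

/-- On the torus, Mathlib's Fourier monomial `fourier n` is the exponential `x ↦ e^{inx}`. -/
theorem fourier_torus_apply (n : ℤ) (x : ℝ) :
    (fourier n ((x : ℝ) : Torus) : ℂ) = Complex.exp (Complex.I * n * x) := by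
  rw [fourier_coe_apply]
  congr 1
  have h : (Real.pi : ℂ) ≠ 0 := by exact_mod_cast Real.pi_ne_zero
  push_cast
  field_simp

/-- The exponential system `E(Λ) = {e^{iλx}}`, `λ ∈ Λ`, as a family of vectors in `L²(S)`, where
`L²(S)` is taken with respect to Lebesgue measure restricted to `S`. -/
noncomputable def expSystem (S : Set Torus) (Λ : Set ℤ) :
    Λ → Lp ℂ 2 ((volume : Measure Torus).restrict S) :=
  fun l => ContinuousMap.toLp 2 ((volume : Measure Torus).restrict S) ℂ (fourier (l : ℤ))

/-- `Λ = {⋯ < λ₀ < λ₁ < λ₂ < ⋯} ⊆ ℤ` is syndetic if its consecutive gaps are bounded. -/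
def IsSyndetic (Λ : Set ℤ) : Prop :=
  ∃ l : ℤ → ℤ, StrictMono l ∧ Set.range l = Λ ∧ ∃ d : ℤ, ∀ j, l (j + 1) - l j ≤ d

/-- The set of the values of the gaps `y - x` between consecutive elements `x < y` of `Λ`. -/
def consecutiveGaps (Λ : Set ℤ) : Set ℤ :=
  {g | ∃ x ∈ Λ, ∃ y ∈ Λ, x < y ∧ (∀ z ∈ Λ, z ≤ x ∨ y ≤ z) ∧ g = y - x}

/-- The simple quasicrystal `Λ(α, I) = {n ∈ ℤ | {αn} ∈ I}`. -/
def simpleQuasicrystal (α : ℝ) (I : Set ℝ) : Set ℤ :=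
  {n : ℤ | Int.fract (α * n) ∈ I}

/-- `Λ` is a simple quasicrystal: `Λ = Λ(α, [a, b))` for an irrational `α` and an interval
`[a, b) ⊆ [0, 1]`. -/
def IsSimpleQuasicrystal (Λ : Set ℤ) : Prop :=
  ∃ α a b : ℝ, Irrational α ∧ 0 ≤ a ∧ a < b ∧ b ≤ 1 ∧ Λ = simpleQuasicrystal α (Set.Ico a b)

/-! The core is `exists_irrational_isRieszSequence`: if `τ < |S|/2π`, slopes `α` for which every
`Λ(α, [a, b))` with `b - a ≤ τ` works are dense in `(0, 1)`. For a rational slope `p/q`, membership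
forces `p n` into about `qτ` consecutive residues mod `q`. Up to a unimodular factor, on each coset
of the `q`-th roots of unity such a trigonometric polynomial is an algebraic polynomial of degree
below `N`, with `N` slightly above `qτ`. A bump function `φ` supported in `S`, with integral above
`2πτ`, is by equidistribution bounded below at `N` points or more of every coset, and these values
determine the polynomial. Integrating over cosets gives a lower bound
(`trigPoly_weighted_lower_bound`). An irrational `α` close enough to `p/q` keeps this residue
condition on windows of length `L` (`exists_window_residues`). Averaging over windows extends the
bound to all frequencies with loss `O(1/L)` (`toeplitz_form_lower_bound`, `exists_window_length`).
This `L` is fixed before `α`, so `α` can be chosen last. It remains to choose `α` and the interval: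
an interval whose complement in the circle has length `(d - 1)α` gives gaps `1` and `d`. Part (1)
takes `α` near `1/d`; part (2) takes `d = 2` and `α` comparable to `|Sᶜ|`, apart from the easy cases
of null or large `Sᶜ`. -/

/-! ### Finite interpolation and Toeplitz forms -/

/-- On `q`-th roots of unity, a polynomial of degree less than `N` is controlled by its values at
any `N` of them. -/
theorem exists_sampling_constant {ζ : ℂ} {q : ℕ} (hζ : IsPrimitiveRoot ζ q) (N : ℕ) :
    ∃ A : ℝ, 0 < A ∧ ∀ K ⊆ Finset.range q, N ≤ K.card → ∀ c : ℕ → ℂ,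
      A * ∑ k ∈ Finset.range q, ‖∑ i ∈ Finset.range N, c i * (ζ ^ k) ^ i‖ ^ 2 ≤
        ∑ k ∈ K, ‖∑ i ∈ Finset.range N, c i * (ζ ^ k) ^ i‖ ^ 2 := by
  classical
  -- `D K` is the Cauchy–Schwarz constant of Lagrange interpolation from the nodes in `K`. Summing
  -- over all `K` below removes the dependence on `K`.
  set D : Finset ℕ → ℝ := fun K => ∑ l ∈ Finset.range q, ∑ k ∈ K,
    ‖(Lagrange.basis K (fun k => ζ ^ k) k).eval (ζ ^ l)‖ ^ 2 with hD
  have hD0 : ∀ K, 0 ≤ D K := fun K => by positivity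
  set M : ℝ := 1 + ∑ K ∈ (Finset.range q).powerset, D K with hM
  have hM0 : 0 < M := by
    have : 0 ≤ ∑ K ∈ (Finset.range q).powerset, D K := Finset.sum_nonneg fun K _ => hD0 K
    linarith
  refine ⟨M⁻¹, inv_pos.2 hM0, fun K hK hN c => ?_⟩
  set P : Polynomial ℂ := ∑ i ∈ Finset.range N, Polynomial.C (c i) * Polynomial.X ^ i with hP
  have hev : ∀ z : ℂ, P.eval z = ∑ i ∈ Finset.range N, c i * z ^ i := fun z => by
    simp [hP, Polynomial.eval_finsetSum]
  have hdeg : P.degree < K.card := by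
    refine (Polynomial.degree_sum_le _ _).trans_lt ?_
    refine (Finset.sup_lt_iff (WithBot.bot_lt_coe _)).2 fun i hi => ?_
    refine (Polynomial.degree_C_mul_X_pow_le i (c i)).trans_lt ?_
    exact_mod_cast (Finset.mem_range.1 hi).trans_le hN
  have hinj : Set.InjOn (fun k : ℕ => ζ ^ k) K := fun a ha b hb h =>
    hζ.pow_inj (Finset.mem_range.1 (hK ha)) (Finset.mem_range.1 (hK hb)) h
  have hint := Lagrange.eq_interpolate hinj hdeg
  have hl : ∀ l, P.eval (ζ ^ l) = ∑ k ∈ K, P.eval (ζ ^ k) *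
      (Lagrange.basis K (fun k => ζ ^ k) k).eval (ζ ^ l) := fun l => by
    conv_lhs => rw [hint]
    simp [Lagrange.interpolate_apply, Polynomial.eval_finsetSum]
  simp only [← hev]
  have key : ∑ l ∈ Finset.range q, ‖P.eval (ζ ^ l)‖ ^ 2 ≤
      D K * ∑ k ∈ K, ‖P.eval (ζ ^ k)‖ ^ 2 := by
    rw [hD, Finset.sum_mul]
    refine Finset.sum_le_sum fun l _ => ?_
    rw [hl l]
    calc _ ≤ (∑ k ∈ K, ‖P.eval (ζ ^ k)‖ *
        ‖(Lagrange.basis K (fun k => ζ ^ k) k).eval (ζ ^ l)‖) ^ 2 := by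
          gcongr
          exact (norm_sum_le _ _).trans (le_of_eq (by simp))
      _ ≤ _ := by
          rw [mul_comm]
          exact Finset.sum_mul_sq_le_sq_mul_sq _ _ _
  rw [inv_mul_le_iff₀ hM0]
  refine key.trans ?_
  gcongr
  have := Finset.single_le_sum (f := D) (fun K _ => hD0 K) (Finset.mem_powerset.2 hK)
  linarith

open scoped ComplexConjugate in
/-- A Toeplitz form with finitely many nonzero diagonals that is bounded below on all windows of
length `L` is bounded below, with a loss of order `1 / L`. -/
theorem toeplitz_form_lower_bound (g : ℤ → ℂ) (t : Finset ℤ) (hg : ∀ k ∉ t, g k = 0)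
    (L : ℕ) (A : ℝ) (s : Finset ℤ) (a : ℤ → ℂ)
    (hwin : ∀ j : ℤ, A * ∑ n ∈ s with j ≤ n ∧ n < j + L, ‖a n‖ ^ 2 ≤
      (∑ n ∈ s with j ≤ n ∧ n < j + L, ∑ m ∈ s with j ≤ m ∧ m < j + L,
        a n * conj (a m) * g (n - m)).re) :
    (A * L - ∑ k ∈ t, |(k : ℝ)| * ‖g k‖) * ∑ n ∈ s, ‖a n‖ ^ 2 ≤
      L * (∑ n ∈ s, ∑ m ∈ s, a n * conj (a m) * g (n - m)).re := by
  classical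
  obtain ⟨B, hB⟩ : ∃ B : ℤ, ∀ n ∈ s, |n| ≤ B := by
    refine ⟨∑ n ∈ s, |n|, fun n hn => Finset.single_le_sum (f := fun n : ℤ => |n|)
      (fun _ _ => abs_nonneg _) hn⟩
  set J : Finset ℤ := Finset.Icc (-B - L) B with hJ
  -- The number of windows containing both `n` and `m`, namely `max (L - |n - m|) 0`. Summing the
  -- window bounds replaces the weight `L` by this one, an error of at most `|n - m|`.
  set w : ℤ → ℤ → ℕ := fun n m =>
    (J.filter fun j => (j ≤ n ∧ n < j + L) ∧ (j ≤ m ∧ m < j + L)).card with hw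
  have hwval : ∀ n ∈ s, ∀ m ∈ s, w n m = (min n m - max n m + L).toNat := by
    intro n hn m hm
    have h1 := abs_le.1 (hB n hn)
    have h2 := abs_le.1 (hB m hm)
    have : (J.filter fun j => (j ≤ n ∧ n < j + L) ∧ (j ≤ m ∧ m < j + L)) =
        Finset.Ioc (max n m - L) (min n m) := by
      ext j
      simp only [hJ, Finset.mem_filter, Finset.mem_Icc, Finset.mem_Ioc]
      omega
    simp only [hw, this, Int.card_Ioc]
    congr 1
    ring
  have hwdiag : ∀ n ∈ s, w n n = L := fun n hn => by rw [hwval n hn n hn]; simp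
  have hwerr : ∀ n ∈ s, ∀ m ∈ s, |(L : ℝ) - w n m| ≤ |((n - m : ℤ) : ℝ)| := by
    intro n hn m hm
    rw [hwval n hn m hm]
    have : |(L : ℤ) - ((min n m - max n m + L).toNat : ℤ)| ≤ |n - m| := by
      rcases le_total n m with h | h
      · rw [min_eq_left h, max_eq_right h, abs_le, abs_of_nonpos (by omega)]; omega
      · rw [min_eq_right h, max_eq_left h, abs_le, abs_of_nonneg (by omega)]; omega
    exact_mod_cast this
  have hsumL : ∑ j ∈ J, ∑ n ∈ s with j ≤ n ∧ n < j + L, ‖a n‖ ^ 2 = L * ∑ n ∈ s, ‖a n‖ ^ 2 := by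
    simp only [Finset.sum_filter]
    rw [Finset.sum_comm, Finset.mul_sum]
    refine Finset.sum_congr rfl fun n hn => ?_
    rw [← Finset.sum_filter, Finset.sum_const, nsmul_eq_mul]
    have := hwdiag n hn
    simp only [hw, and_self] at this
    rw [this]
  have hsumQ : ∑ j ∈ J, ∑ n ∈ s with j ≤ n ∧ n < j + L, ∑ m ∈ s with j ≤ m ∧ m < j + L,
        a n * conj (a m) * g (n - m) =
      ∑ n ∈ s, ∑ m ∈ s, (w n m : ℂ) * (a n * conj (a m) * g (n - m)) := by
    simp only [Finset.sum_filter]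
    rw [Finset.sum_comm]
    refine Finset.sum_congr rfl fun n _ => ?_
    have : ∀ j : ℤ, (if j ≤ n ∧ n < j + L then ∑ m ∈ s,
        (if j ≤ m ∧ m < j + L then a n * conj (a m) * g (n - m) else 0) else 0) =
        ∑ m ∈ s, if (j ≤ n ∧ n < j + L) ∧ (j ≤ m ∧ m < j + L) then
          a n * conj (a m) * g (n - m) else 0 := fun j => by
      by_cases h : j ≤ n ∧ n < j + L <;> simp [h]
    simp only [this]
    rw [Finset.sum_comm]
    refine Finset.sum_congr rfl fun m _ => ?_
    rw [← Finset.sum_filter, Finset.sum_const, nsmul_eq_mul]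
  have h1 : A * (L * ∑ n ∈ s, ‖a n‖ ^ 2) ≤
      (∑ n ∈ s, ∑ m ∈ s, (w n m : ℂ) * (a n * conj (a m) * g (n - m))).re := by
    rw [← hsumQ, ← hsumL, Finset.mul_sum, Complex.re_sum]
    exact Finset.sum_le_sum fun j _ => hwin j
  have h2 : ‖(L : ℂ) * (∑ n ∈ s, ∑ m ∈ s, a n * conj (a m) * g (n - m)) -
      ∑ n ∈ s, ∑ m ∈ s, (w n m : ℂ) * (a n * conj (a m) * g (n - m))‖ ≤
      (∑ k ∈ t, |(k : ℝ)| * ‖g k‖) * ∑ n ∈ s, ‖a n‖ ^ 2 := by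
    have heq : (L : ℂ) * (∑ n ∈ s, ∑ m ∈ s, a n * conj (a m) * g (n - m)) -
        ∑ n ∈ s, ∑ m ∈ s, (w n m : ℂ) * (a n * conj (a m) * g (n - m)) =
        ∑ n ∈ s, ∑ m ∈ s, ((L : ℂ) - w n m) * (a n * conj (a m) * g (n - m)) := by
      simp only [Finset.mul_sum, ← Finset.sum_sub_distrib, ← sub_mul]
    rw [heq]
    -- Schur test: AM–GM on each diagonal `n - m = k` makes its total cost at most `|k| ‖g k‖ ∑ ‖a
    -- n‖ ^ 2`.
    have hterm : ∀ n ∈ s, ∀ m ∈ s, ‖((L : ℂ) - w n m) * (a n * conj (a m) * g (n - m))‖ ≤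
        ∑ k ∈ t, if n - m = k then |(k : ℝ)| * ‖g k‖ * (‖a n‖ ^ 2 / 2 + ‖a m‖ ^ 2 / 2) else 0 := by
      intro n hn m hm
      rw [Finset.sum_ite_eq]
      split_ifs with hk
      · have h3 : ‖(L : ℂ) - w n m‖ ≤ |((n - m : ℤ) : ℝ)| := by
          refine le_trans (le_of_eq ?_) (hwerr n hn m hm)
          rw [← Real.norm_eq_abs, ← Complex.norm_real]
          push_cast; rfl
        have h4 : ‖a n‖ * ‖a m‖ ≤ ‖a n‖ ^ 2 / 2 + ‖a m‖ ^ 2 / 2 := by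
          nlinarith [sq_nonneg (‖a n‖ - ‖a m‖)]
        calc _ = ‖(L : ℂ) - w n m‖ * ‖g (n - m)‖ * (‖a n‖ * ‖a m‖) := by
              simp only [norm_mul, RCLike.norm_conj]; ring
          _ ≤ _ := by gcongr
      · simp [hg _ hk]
    calc _ ≤ ∑ n ∈ s, ∑ m ∈ s, ∑ k ∈ t,
          (if n - m = k then |(k : ℝ)| * ‖g k‖ * (‖a n‖ ^ 2 / 2 + ‖a m‖ ^ 2 / 2) else 0) :=
          (norm_sum_le _ _).trans (Finset.sum_le_sum fun n hn =>
            (norm_sum_le _ _).trans (Finset.sum_le_sum fun m hm => hterm n hn m hm))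
      _ = ∑ k ∈ t, |(k : ℝ)| * ‖g k‖ * ((∑ n ∈ s, ∑ m ∈ s, if n - m = k then ‖a n‖ ^ 2 / 2 else 0) +
          ∑ n ∈ s, ∑ m ∈ s, if n - m = k then ‖a m‖ ^ 2 / 2 else 0) := by
          rw [Finset.sum_congr rfl (fun n _ => Finset.sum_comm), Finset.sum_comm]
          refine Finset.sum_congr rfl fun k _ => ?_
          rw [← Finset.sum_add_distrib, Finset.mul_sum]
          refine Finset.sum_congr rfl fun n _ => ?_
          rw [← Finset.sum_add_distrib, Finset.mul_sum]
          refine Finset.sum_congr rfl fun m _ => ?_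
          split_ifs <;> ring
      _ ≤ _ := by
          rw [Finset.sum_mul]
          refine Finset.sum_le_sum fun k _ => ?_
          have e1 : ∀ n ∈ s, (∑ m ∈ s, if n - m = k then ‖a n‖ ^ 2 / 2 else 0) ≤ ‖a n‖ ^ 2 / 2 := by
            intro n _
            have : ∀ m : ℤ, (n - m = k) = (n - k = m) := fun m => by
              apply propext; omega
            simp only [this, Finset.sum_ite_eq]
            split_ifs
            · exact le_rfl
            · positivity
          have e2 : ∀ m ∈ s, (∑ n ∈ s, if n - m = k then ‖a m‖ ^ 2 / 2 else 0) ≤ ‖a m‖ ^ 2 / 2 := by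
            intro m _
            have : ∀ n : ℤ, (n - m = k) = (m + k = n) := fun n => by
              apply propext; omega
            simp only [this, Finset.sum_ite_eq]
            split_ifs
            · exact le_rfl
            · positivity
          gcongr
          rw [Finset.sum_comm (f := fun n m => if n - m = k then ‖a m‖ ^ 2 / 2 else 0)]
          refine (add_le_add (Finset.sum_le_sum e1) (Finset.sum_le_sum e2)).trans (le_of_eq ?_)
          rw [← Finset.sum_add_distrib]
          exact Finset.sum_congr rfl fun n _ => by ring
  have h3 := (Complex.abs_re_le_norm _).trans h2
  rw [Complex.sub_re, abs_le] at h3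
  have h4 : ((L : ℂ) * (∑ n ∈ s, ∑ m ∈ s, a n * conj (a m) * g (n - m))).re =
      L * (∑ n ∈ s, ∑ m ∈ s, a n * conj (a m) * g (n - m)).re := by
    rw [← Complex.ofReal_natCast, Complex.re_ofReal_mul]
  rw [h4] at h3
  linarith [h3.1]

/-! ### Gaps of simple quasicrystals -/

/-- A set of integers that is unbounded in both directions and whose consecutive gaps are bounded
is syndetic. -/
theorem isSyndetic_of_consecutiveGaps_le {Λ : Set ℤ} (hne : Λ.Nonempty)
    (hup : ∀ n ∈ Λ, ∃ m ∈ Λ, n < m) (hdown : ∀ n ∈ Λ, ∃ m ∈ Λ, m < n) {d : ℤ}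
    (hgap : ∀ g ∈ consecutiveGaps Λ, g ≤ d) : IsSyndetic Λ := by
  classical
  have : Nonempty Λ := hne.to_subtype
  have : NoMaxOrder Λ := ⟨fun n => by
    obtain ⟨m, hm, h⟩ := hup n n.2
    exact ⟨⟨m, hm⟩, h⟩⟩
  have : NoMinOrder Λ := ⟨fun n => by
    obtain ⟨m, hm, h⟩ := hdown n n.2
    exact ⟨⟨m, hm⟩, h⟩⟩
  let _ : LocallyFiniteOrder Λ := LocallyFiniteOrder.ofFiniteIcc fun a b => by
    refine Set.Finite.of_finite_image (f := Subtype.val) ?_ Subtype.val_injective.injOn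
    refine (Set.finite_Icc (a : ℤ) b).subset ?_
    rintro _ ⟨x, hx, rfl⟩
    exact ⟨hx.1, hx.2⟩
  let _ : SuccOrder Λ := LinearLocallyFiniteOrder.succOrder Λ
  let _ : PredOrder Λ := LinearLocallyFiniteOrder.predOrder Λ
  let e : Λ ≃o ℤ := orderIsoIntOfLinearSuccPredArch
  refine ⟨fun j => (e.symm j : ℤ), fun i j hij => e.symm.strictMono hij, ?_, d, fun j => ?_⟩
  · ext x
    constructor
    · rintro ⟨j, rfl⟩
      exact (e.symm j).2
    · intro hx
      exact ⟨e ⟨x, hx⟩, by simp⟩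
  · refine hgap _ ⟨_, (e.symm j).2, _, (e.symm (j + 1)).2, e.symm.strictMono (lt_add_one j),
      fun z hz => ?_, rfl⟩
    rcases le_or_gt (e ⟨z, hz⟩) j with h | h
    · left
      have := e.symm.monotone h
      rw [OrderIso.symm_apply_apply] at this
      exact this
    · right
      have := e.symm.monotone (Int.add_one_le_of_lt h)
      rw [OrderIso.symm_apply_apply] at this
      exact this

theorem mem_simpleQuasicrystal_Ico_iff {α b : ℝ} {n : ℤ} (hb : b ≤ 1) :
    n ∈ simpleQuasicrystal α (Set.Ico 0 b) ↔ ∃ k : ℤ, (k : ℝ) ≤ α * n ∧ α * n < k + b := by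
  simp only [simpleQuasicrystal, Set.mem_ofPred_eq, Set.mem_Ico, Int.fract_nonneg, true_and]
  constructor
  · intro h
    exact ⟨⌊α * n⌋, Int.floor_le _, by rw [Int.fract] at h; linarith⟩
  · rintro ⟨k, h1, h2⟩
    have : ⌊α * n⌋ = k := Int.floor_eq_iff.2 ⟨h1, by linarith⟩
    rw [Int.fract, this]
    linarith

/-- If `0 < dα < 1`, then the simple quasicrystal `Λ(α, [0, 1 - (d - 1)α))` has exactly the gaps
`1` and `d`. -/
theorem simpleQuasicrystal_two_gaps {α : ℝ} {d : ℕ} (hα : 0 < α) (hd : 1 < d) (hdα : d * α < 1) :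
    IsSyndetic (simpleQuasicrystal α (Set.Ico 0 (1 - (d - 1) * α))) ∧
      consecutiveGaps (simpleQuasicrystal α (Set.Ico 0 (1 - (d - 1) * α))) = {1, (d : ℤ)} := by
  have hd' : (2 : ℝ) ≤ d := by exact_mod_cast hd
  set b : ℝ := 1 - (d - 1) * α with hb
  have hb1 : b ≤ 1 := by nlinarith
  have hbα : α < b := by rw [hb]; linarith
  set Λ := simpleQuasicrystal α (Set.Ico 0 b) with hΛ
  have hmem : ∀ n : ℤ, n ∈ Λ ↔ ∃ k : ℤ, (k : ℝ) ≤ α * n ∧ α * n < k + b := fun n =>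
    mem_simpleQuasicrystal_Ico_iff hb1
  -- The complementary arc has length `(d - 1)α`. An orbit leaving `[0, b)` therefore spends exactly
  -- `d - 1` steps in it.
  have hstep : ∀ n ∈ Λ, n + 1 ∈ Λ ∨ (n + d ∈ Λ ∧ ∀ z ∈ Λ, z ≤ n ∨ n + d ≤ z) := by
    intro n hn
    obtain ⟨k, h1, h2⟩ := (hmem n).1 hn
    by_cases h : α * n < k + b - α
    · left
      refine (hmem _).2 ⟨k, ?_, ?_⟩ <;> push_cast <;> linarith
    · right
      push Not at h
      refine ⟨(hmem _).2 ⟨k + 1, ?_, ?_⟩, fun z hz => ?_⟩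
      · push_cast; rw [hb] at h; linarith
      · push_cast; rw [hb] at h2; linarith
      · by_contra! hcon
        obtain ⟨j, h3, h4⟩ := (hmem z).1 hz
        have hz1 : (n : ℝ) + 1 ≤ z := by exact_mod_cast hcon.1
        have hz2 : (z : ℝ) + 1 ≤ n + d := by exact_mod_cast hcon.2
        have h5 : α * (n + 1) ≤ α * z := by gcongr
        have h6 : α * (z + 1) ≤ α * (n + d) := by gcongr
        have hj1 : j < k + 1 := by
          have : (j : ℝ) < k + 1 := by rw [hb] at h2; linarith
          exact_mod_cast this
        have hj2 : (j : ℝ) ≤ k := by exact_mod_cast Int.lt_add_one_iff.1 hj1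
        linarith
  have hprev : ∀ n ∈ Λ, n - 1 ∈ Λ ∨ n - d ∈ Λ := by
    intro n hn
    obtain ⟨k, h1, h2⟩ := (hmem n).1 hn
    by_cases h : k + α ≤ α * n
    · left
      refine (hmem _).2 ⟨k, ?_, ?_⟩ <;> push_cast <;> linarith
    · right
      push Not at h
      refine (hmem _).2 ⟨k - 1, ?_, ?_⟩
      · push_cast; linarith
      · push_cast; rw [hb]; linarith
  have hdpos : (0 : ℤ) < d := by omega
  have hzero : (0 : ℤ) ∈ Λ := (hmem 0).2 ⟨0, by simp, by simp; linarith⟩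
  have hone : (1 : ℤ) ∈ Λ := (hmem 1).2 ⟨0, by simp; linarith, by simp; linarith⟩
  have hgaps : consecutiveGaps Λ = {1, (d : ℤ)} := by
    ext g
    simp only [consecutiveGaps, Set.mem_ofPred_eq, Set.mem_insert_iff, Set.mem_singleton_iff]
    constructor
    · rintro ⟨x, hx, y, hy, hxy, hz, rfl⟩
      rcases hstep x hx with h | ⟨h, h'⟩
      · left
        rcases hz _ h with h | h <;> omega
      · right
        rcases hz _ h with h | h <;> rcases h' _ hy with h' | h' <;> omega
    · rintro (rfl | rfl)
      · exact ⟨0, hzero, 1, hone, by omega, fun z _ => by omega, by omega⟩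
      -- The gap `d` occurs from `-d` to `0`: at `-d + 1` the orbit hits `-(d - 1)α = b - 1`, the
      -- excluded right endpoint.
      · have hnd : (-(d : ℤ)) ∈ Λ := by
          refine (hmem _).2 ⟨-1, ?_, ?_⟩ <;> push_cast <;> nlinarith
        have hnd1 : (-(d : ℤ) + 1) ∉ Λ := by
          intro h
          obtain ⟨j, h1, h2⟩ := (hmem _).1 h
          push_cast at h1 h2
          have hj1 : j < 0 := by
            have : (j : ℝ) < 0 := by nlinarith
            exact_mod_cast this
          have hj2 : (j : ℝ) ≤ -1 := by exact_mod_cast Int.le_sub_one_of_lt hj1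
          rw [hb] at h2
          linarith
        rcases hstep _ hnd with h | ⟨h, h'⟩
        · exact absurd h hnd1
        · refine ⟨_, hnd, 0, hzero, by omega, fun z hz => ?_, by omega⟩
          rcases h' z hz with h | h <;> omega
  refine ⟨isSyndetic_of_consecutiveGaps_le ⟨0, hzero⟩ (fun n hn => ?_) (fun n hn => ?_)
    (d := d) (fun g hg => ?_), hgaps⟩
  · rcases hstep n hn with h | ⟨h, -⟩
    · exact ⟨_, h, by omega⟩
    · exact ⟨_, h, by omega⟩
  · rcases hprev n hn with h | h
    · exact ⟨_, h, by omega⟩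
    · exact ⟨_, h, by omega⟩
  · rw [hgaps] at hg
    rcases hg with rfl | rfl
    · omega
    · exact le_rfl

/-- The complement of `Λ(α, [0, 1 - α))` is separated by more than `1 / α - 1`. -/
theorem abs_sub_of_notMem_simpleQuasicrystal {α : ℝ} (hα : 0 < α) {n m : ℤ}
    (hn : n ∉ simpleQuasicrystal α (Set.Ico 0 (1 - α)))
    (hm : m ∉ simpleQuasicrystal α (Set.Ico 0 (1 - α))) (hnm : n ≠ m) :
    1 / α - 1 ≤ |(n : ℝ) - m| := by
  wlog h : m < n generalizing n m
  · rw [abs_sub_comm]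
    exact this hm hn hnm.symm (lt_of_le_of_ne (not_lt.1 h) hnm)
  have key : ∀ k : ℤ, k ∉ simpleQuasicrystal α (Set.Ico 0 (1 - α)) →
      1 - α ≤ α * k - ⌊α * k⌋ := by
    intro k hk
    by_contra! hcon
    exact hk ⟨Int.fract_nonneg _, hcon⟩
  have h1 := key n hn
  have h2 := key m hm
  have h3 := Int.lt_floor_add_one (α * n)
  have h4 := Int.lt_floor_add_one (α * m)
  have hnm' : (m : ℝ) + 1 ≤ n := by exact_mod_cast h
  -- A missing point lies in the last stretch of length `α` of its period, so a further step of `α`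
  -- leaves that period.
  have h5 : ⌊α * m⌋ + 1 ≤ ⌊α * n⌋ := by
    have : (⌊α * m⌋ : ℝ) < ⌊α * n⌋ := by nlinarith
    exact_mod_cast this
  have h6 : (⌊α * m⌋ : ℝ) + 1 ≤ ⌊α * n⌋ := by exact_mod_cast h5
  rw [abs_of_nonneg (by linarith), div_sub_one hα.ne', div_le_iff₀ hα]
  nlinarith

/-- Serves the case of null `Sᶜ`, where the complement of `Λ` may contain only one point. -/
theorem consecutiveGaps_compl_zero : consecutiveGaps ({0}ᶜ : Set ℤ) = {1, 2} := by
  ext g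
  simp only [consecutiveGaps, Set.mem_ofPred_eq, Set.mem_insert_iff, Set.mem_singleton_iff,
    Set.mem_compl_iff]
  constructor
  · rintro ⟨x, hx, y, hy, hxy, hz, rfl⟩
    have h1 := hz (x + 1)
    have h2 := hz (x + 2)
    omega
  · rintro (rfl | rfl)
    · exact ⟨1, by omega, 2, by omega, by omega, fun z _ => by omega, by omega⟩
    · exact ⟨-1, by omega, 1, by omega, by omega, fun z _ => by omega, by omega⟩

theorem isSyndetic_compl_zero : IsSyndetic ({0}ᶜ : Set ℤ) := by
  refine isSyndetic_of_consecutiveGaps_le (d := 2) ⟨1, by simp⟩ (fun n hn => ?_) (fun n hn => ?_)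
    (fun g hg => ?_)
  · rcases eq_or_ne n (-1) with rfl | h
    · exact ⟨1, by simp, by omega⟩
    · exact ⟨n + 1, by simp; omega, by omega⟩
  · rcases eq_or_ne n 1 with rfl | h
    · exact ⟨-1, by simp, by omega⟩
    · exact ⟨n - 1, by simp; omega, by omega⟩
  · rw [consecutiveGaps_compl_zero] at hg
    rcases hg with rfl | rfl <;> omega

/-! ### Trigonometric polynomials on the torus -/

/-- The trigonometric polynomial `∑ aₙ e^{inx}`. -/
noncomputable def trigPoly (s : Finset ℤ) (a : ℤ → ℂ) : C(Torus, ℂ) :=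
  ∑ n ∈ s, a n • fourier n

theorem trigPoly_apply (s : Finset ℤ) (a : ℤ → ℂ) (x : Torus) :
    trigPoly s a x = ∑ n ∈ s, a n * fourier n x := by
  simp [trigPoly, ContinuousMap.sum_apply]

theorem integrable_torus {E : Type*} [NormedAddCommGroup E] {f : Torus → E} (hf : Continuous f) :
    Integrable f volume :=
  hf.integrable_of_hasCompactSupport (HasCompactSupport.of_compactSpace _)

theorem volume_real_univ_torus : (volume : Measure Torus).real Set.univ = 2 * Real.pi := by
  simp [Measure.real, AddCircle.measure_univ, Real.pi_pos.le]

/-- For `k ≠ 0`, translation by half a period of the character flips its sign but preserves the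
integral. -/
theorem integral_fourier_torus (k : ℤ) :
    ∫ x : Torus, fourier k x = if k = 0 then (2 * Real.pi : ℂ) else 0 := by
  split_ifs with hk
  · subst hk
    simp [Measure.real, AddCircle.measure_univ, Real.pi_pos.le]
  · have h := integral_add_right_eq_self (μ := (volume : Measure Torus))
      (fun x => (fourier k x : ℂ)) (((2 * Real.pi / 2 / k : ℝ)) : Torus)
    simp only [fourier_add_half_inv_index hk Real.two_pi_pos, integral_neg] at h
    exact self_eq_neg.1 h.symm

theorem fourier_apply_add (n : ℤ) (x y : Torus) :
    (fourier n (x + y) : ℂ) = fourier n x * fourier n y := by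
  simp [fourier_apply, smul_add, AddCircle.toCircle_add]

theorem fourier_nsmul (n : ℤ) (k : ℕ) (x : Torus) :
    (fourier n (k • x) : ℂ) = fourier n x ^ k := by
  induction k with
  | zero => simp
  | succ k ih => rw [succ_nsmul, fourier_apply_add, ih, pow_succ]

-- Weighted energies are Toeplitz forms in the coefficients; this gives access to
-- `toeplitz_form_lower_bound`.
open scoped ComplexConjugate in
theorem integral_mul_norm_trigPoly_sq (ψ : C(Torus, ℂ)) (s : Finset ℤ) (a : ℤ → ℂ) :
    ∫ x, ψ x * ((‖trigPoly s a x‖ ^ 2 : ℝ) : ℂ) =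
      ∑ n ∈ s, ∑ m ∈ s, a n * conj (a m) * ∫ x, ψ x * fourier (n - m) x := by
  have h : ∀ x, ψ x * ((‖trigPoly s a x‖ ^ 2 : ℝ) : ℂ) =
      ∑ n ∈ s, ∑ m ∈ s, a n * conj (a m) * (ψ x * fourier (n - m) x) := by
    intro x
    rw [← Complex.normSq_eq_norm_sq, ← Complex.mul_conj, trigPoly_apply, map_sum,
      Finset.sum_mul_sum, Finset.mul_sum]
    refine Finset.sum_congr rfl fun n _ => ?_
    rw [Finset.mul_sum]
    refine Finset.sum_congr rfl fun m _ => ?_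
    rw [sub_eq_add_neg, fourier_add, fourier_neg, map_mul]
    ring
  have hi : ∀ n m : ℤ, Integrable (fun x : Torus =>
      a n * conj (a m) * (ψ x * fourier (n - m) x)) volume := fun n m =>
    integrable_torus (by fun_prop)
  simp only [h]
  rw [integral_finsetSum _ fun n _ => integrable_finsetSum _ fun m _ => hi n m]
  refine Finset.sum_congr rfl fun n _ => ?_
  rw [integral_finsetSum _ fun m _ => hi n m]
  exact Finset.sum_congr rfl fun m _ => integral_const_mul _ _

theorem integral_norm_trigPoly_sq (s : Finset ℤ) (a : ℤ → ℂ) :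
    ∫ x, ‖trigPoly s a x‖ ^ 2 = 2 * Real.pi * ∑ n ∈ s, ‖a n‖ ^ 2 := by
  have h := integral_mul_norm_trigPoly_sq 1 s a
  simp only [ContinuousMap.one_apply, one_mul, integral_fourier_torus, sub_eq_zero, mul_ite,
    mul_zero, Finset.sum_ite_eq] at h
  rw [integral_complex_ofReal] at h
  have h2 : (∑ n ∈ s, if n ∈ s then a n * (starRingEnd ℂ) (a n) * (2 * Real.pi : ℂ) else 0) =
      ((2 * Real.pi * ∑ n ∈ s, ‖a n‖ ^ 2 : ℝ) : ℂ) := by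
    push_cast
    rw [Finset.mul_sum]
    refine Finset.sum_congr rfl fun n hn => ?_
    rw [if_pos hn, Complex.mul_conj, Complex.normSq_eq_norm_sq]
    push_cast
    ring
  rw [h2] at h
  exact_mod_cast h

theorem norm_toLp_sq (μ : Measure Torus) [IsFiniteMeasure μ] (f : C(Torus, ℂ)) :
    ‖ContinuousMap.toLp 2 μ ℂ f‖ ^ 2 = ∫ x, ‖f x‖ ^ 2 ∂μ := by
  have h := ContinuousMap.inner_toLp (𝕜 := ℂ) μ f f
  rw [inner_self_eq_norm_sq_to_K] at h
  simp only [Complex.mul_conj, Complex.normSq_eq_norm_sq] at h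
  rw [integral_complex_ofReal] at h
  exact Complex.ofReal_injective (by simpa using h)

/-- A Riesz sequence criterion for exponentials: only the lower bound needs to be checked. -/
theorem isRieszSequence_expSystem {S : Set Torus} {Λ : Set ℤ} {A : ℝ} (hA : 0 < A)
    (h : ∀ (s : Finset ℤ) (a : ℤ → ℂ), (∀ n ∈ s, n ∈ Λ) →
      A * ∑ n ∈ s, ‖a n‖ ^ 2 ≤ ∫ x in S, ‖trigPoly s a x‖ ^ 2) :
    IsRieszSequence (expSystem S Λ) := by
  classical
  refine ⟨A, max A (2 * Real.pi), hA, le_max_left _ _, fun s a => ?_⟩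
  set s' : Finset ℤ := s.map (Function.Embedding.subtype _) with hs'
  set a' : ℤ → ℂ := fun n => if hn : n ∈ Λ then a ⟨n, hn⟩ else 0 with ha'
  have h1 : ∑ i ∈ s, ‖a i‖ ^ 2 = ∑ n ∈ s', ‖a' n‖ ^ 2 := by
    simp [hs', ha', Finset.sum_map]
  have h2 : ‖∑ i ∈ s, a i • expSystem S Λ i‖ ^ 2 = ∫ x in S, ‖trigPoly s' a' x‖ ^ 2 := by
    rw [← norm_toLp_sq]
    congr 2
    simp [hs', ha', Finset.sum_map, trigPoly, expSystem]
  rw [h1, h2]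
  refine ⟨h s' a' fun n hn => ?_, ?_⟩
  · obtain ⟨m, -, rfl⟩ := Finset.mem_map.1 hn
    exact m.2
  -- The upper bound holds for every `Λ`: enlarge `S` to the torus and apply Parseval.
  · calc _ ≤ ∫ x, ‖trigPoly s' a' x‖ ^ 2 := by
          refine setIntegral_le_integral ?_ (Filter.Eventually.of_forall fun x => by positivity)
          exact integrable_torus (by fun_prop)
      _ = 2 * Real.pi * ∑ n ∈ s', ‖a' n‖ ^ 2 := integral_norm_trigPoly_sq _ _
      _ ≤ _ := by gcongr; exact le_max_right _ _

/-! ### Sampling along rational rotations -/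

theorem fourier_rational (n : ℤ) (p q : ℕ) :
    (fourier n (((2 * Real.pi * p / q : ℝ)) : Torus) : ℂ) =
      Complex.exp (2 * Real.pi * Complex.I / q) ^ ((p : ℤ) * n) := by
  rw [fourier_torus_apply, ← Complex.exp_int_mul]
  congr 1
  push_cast
  ring

/-- If the frequencies `n ∈ s` are such that the `p n` lie in an interval of length `N` modulo `q`,
then `∑ aₙ e^{inx}` is controlled by a weight that is at least `η` at `N` points of each translate
of the `q`-th roots of unity. -/
theorem trigPoly_weighted_lower_bound {φ : C(Torus, ℝ)} (hφ : ∀ x, 0 ≤ φ x) {p q N : ℕ}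
    (hq : q ≠ 0) {η A : ℝ} (hη : 0 ≤ η)
    (hA : ∀ K ⊆ Finset.range q, N ≤ K.card → ∀ c : ℕ → ℂ,
      A * ∑ k ∈ Finset.range q,
        ‖∑ i ∈ Finset.range N, c i * (Complex.exp (2 * Real.pi * Complex.I / q) ^ k) ^ i‖ ^ 2 ≤
      ∑ k ∈ K, ‖∑ i ∈ Finset.range N,
        c i * (Complex.exp (2 * Real.pi * Complex.I / q) ^ k) ^ i‖ ^ 2)
    (hcount : ∀ θ : Torus, N ≤ ((Finset.range q).filter fun k =>
      η ≤ φ (θ + k • ((2 * Real.pi * p / q : ℝ) : Torus))).card)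
    {s : Finset ℤ} (a : ℤ → ℂ) {t : ℤ}
    (hs : ∀ n ∈ s, ∃ i < N, ∃ m : ℤ, p * n = t + (i : ℕ) + q * m) :
    η * A * ∫ x, ‖trigPoly s a x‖ ^ 2 ≤ ∫ x, φ x * ‖trigPoly s a x‖ ^ 2 := by
  classical
  set ζ : ℂ := Complex.exp (2 * Real.pi * Complex.I / q) with hζ
  set c : Torus := ((2 * Real.pi * p / q : ℝ) : Torus) with hc
  have hprim : IsPrimitiveRoot ζ q := Complex.isPrimitiveRoot_exp q hq
  have hζ0 : ζ ≠ 0 := Complex.exp_ne_zero _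
  have hζ1 : ‖ζ‖ = 1 := hprim.norm'_eq_one hq
  choose! i hiN m hm using hs
  have hF : ∀ (θ : Torus) (k : ℕ), ‖trigPoly s a (θ + k • c)‖ =
      ‖∑ l ∈ Finset.range N, (∑ n ∈ s with i n = l, a n * fourier n θ) * (ζ ^ k) ^ l‖ := by
    intro θ k
    -- Only `p n` mod `q` matters on the orbit, so frequencies sharing the residue `t + l` merge
    -- into one coefficient of degree `l`.
    have h1 : trigPoly s a (θ + k • c) = (ζ ^ t) ^ k *
        ∑ l ∈ Finset.range N, (∑ n ∈ s with i n = l, a n * fourier n θ) * (ζ ^ k) ^ l := by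
      have h2 : ∑ l ∈ Finset.range N, (∑ n ∈ s with i n = l, a n * fourier n θ) * (ζ ^ k) ^ l =
          ∑ n ∈ s, a n * fourier n θ * (ζ ^ k) ^ i n := by
        rw [← Finset.sum_fiberwise_of_maps_to (s := s) (t := Finset.range N) (g := i)
          fun n hn => Finset.mem_range.2 (hiN n hn)]
        refine Finset.sum_congr rfl fun l _ => ?_
        rw [Finset.sum_mul]
        refine Finset.sum_congr rfl fun n hn => ?_
        rw [(Finset.mem_filter.1 hn).2]
      rw [h2, trigPoly_apply, Finset.mul_sum]
      refine Finset.sum_congr rfl fun n hn => ?_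
      rw [fourier_apply_add, fourier_nsmul, hc, fourier_rational, hm n hn, ← hζ, zpow_add₀ hζ0,
        zpow_add₀ hζ0, zpow_mul ζ q, zpow_natCast ζ q, hprim.pow_eq_one, one_zpow, mul_one,
        mul_pow, zpow_natCast, ← pow_mul, ← pow_mul, mul_comm (i n)]
      ring
    rw [h1, norm_mul, norm_pow, norm_zpow, hζ1]
    simp
  have hpt : ∀ θ : Torus, η * A * ∑ k ∈ Finset.range q, ‖trigPoly s a (θ + k • c)‖ ^ 2 ≤
      ∑ k ∈ Finset.range q, φ (θ + k • c) * ‖trigPoly s a (θ + k • c)‖ ^ 2 := by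
    intro θ
    have h1 := hA _ (Finset.filter_subset _ _) (hcount θ)
      fun l => ∑ n ∈ s with i n = l, a n * fourier n θ
    simp only [← hF] at h1
    calc _ = η * (A * ∑ k ∈ Finset.range q, ‖trigPoly s a (θ + k • c)‖ ^ 2) := by ring
      _ ≤ η * _ := mul_le_mul_of_nonneg_left h1 hη
      _ ≤ ∑ k ∈ Finset.range q with η ≤ φ (θ + k • c),
          φ (θ + k • c) * ‖trigPoly s a (θ + k • c)‖ ^ 2 := by
          rw [Finset.mul_sum]
          refine Finset.sum_le_sum fun k hk => ?_
          gcongr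
          exact (Finset.mem_filter.1 hk).2
      _ ≤ _ := Finset.sum_le_sum_of_subset_of_nonneg (Finset.filter_subset _ _)
          fun k _ _ => mul_nonneg (hφ _) (by positivity)
  have hint1 : ∀ k : ℕ, Integrable (fun θ => ‖trigPoly s a (θ + k • c)‖ ^ 2) volume := fun k =>
    integrable_torus (by fun_prop)
  have hint2 : ∀ k : ℕ, Integrable
      (fun θ => φ (θ + k • c) * ‖trigPoly s a (θ + k • c)‖ ^ 2) volume := fun k =>
    integrable_torus (by fun_prop)
  -- By translation invariance all `q` terms on each side have equal integrals, and the factor `q`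
  -- cancels.
  have h := integral_mono ((integrable_finsetSum _ fun k _ => hint1 k).const_mul (η * A))
    (integrable_finsetSum (Finset.range q) fun k _ => hint2 k) hpt
  rw [integral_const_mul, integral_finsetSum _ fun k _ => hint1 k,
    integral_finsetSum _ fun k _ => hint2 k] at h
  have e1 : ∀ k : ℕ, ∫ θ, ‖trigPoly s a (θ + k • c)‖ ^ 2 = ∫ θ, ‖trigPoly s a θ‖ ^ 2 := fun k =>
    integral_add_right_eq_self (fun θ => ‖trigPoly s a θ‖ ^ 2) (k • c)
  have e2 : ∀ k : ℕ, ∫ θ, φ (θ + k • c) * ‖trigPoly s a (θ + k • c)‖ ^ 2 =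
      ∫ θ, φ θ * ‖trigPoly s a θ‖ ^ 2 := fun k =>
    integral_add_right_eq_self (fun θ => φ θ * ‖trigPoly s a θ‖ ^ 2) (k • c)
  simp only [e1, e2, Finset.sum_const, Finset.card_range, nsmul_eq_mul] at h
  have hq' : (0 : ℝ) < q := by exact_mod_cast Nat.pos_of_ne_zero hq
  refine le_of_mul_le_mul_left ?_ hq'
  linarith

/-! ### Approximation, equidistribution and windows -/

/-- Trigonometric polynomials are dense in the continuous functions. -/
theorem exists_trigonometric_approx (φ : C(Torus, ℝ)) {ε : ℝ} (hε : 0 < ε) :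
    ∃ ψ ∈ Submodule.span ℂ (Set.range (@fourier (2 * Real.pi))),
      ∀ x, ‖ψ x - (φ x : ℂ)‖ ≤ ε := by
  set f : C(Torus, ℂ) := ⟨fun x => (φ x : ℂ), by fun_prop⟩ with hf
  have h : f ∈ (Submodule.span ℂ (Set.range (@fourier (2 * Real.pi)))).topologicalClosure := by
    rw [span_fourier_closure_eq_top]; trivial
  obtain ⟨ψ, hψ, hd⟩ := Metric.mem_closure_iff.1 h ε hε
  refine ⟨ψ, hψ, fun x => ?_⟩
  rw [← dist_eq_norm, dist_comm]
  exact (ContinuousMap.dist_apply_le_dist (f := f) (g := ψ) x).trans hd.le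

/-- Leaves finitely many diagonals in the Toeplitz form, so the windowing loss is a finite sum. -/
theorem exists_finset_integral_mul_fourier_eq_zero {ψ : C(Torus, ℂ)}
    (hψ : ψ ∈ Submodule.span ℂ (Set.range (@fourier (2 * Real.pi)))) :
    ∃ t : Finset ℤ, ∀ k ∉ t, ∫ x, ψ x * fourier k x = 0 := by
  classical
  induction hψ using Submodule.span_induction with
  | mem f hf =>
    obtain ⟨n, rfl⟩ := hf
    refine ⟨{-n}, fun k hk => ?_⟩
    simp only [← fourier_add, integral_fourier_torus]
    rw [Finset.mem_singleton] at hk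
    exact if_neg (by omega)
  | zero => exact ⟨∅, fun k _ => by simp⟩
  | add f g _ _ hf hg =>
    obtain ⟨t₁, h₁⟩ := hf
    obtain ⟨t₂, h₂⟩ := hg
    refine ⟨t₁ ∪ t₂, fun k hk => ?_⟩
    rw [Finset.notMem_union] at hk
    simp only [ContinuousMap.add_apply, add_mul]
    rw [integral_add (integrable_torus (by fun_prop))
      (integrable_torus (by fun_prop)), h₁ k hk.1, h₂ k hk.2, add_zero]
  | smul c f _ hf =>
    obtain ⟨t, h⟩ := hf
    refine ⟨t, fun k hk => ?_⟩
    simp only [ContinuousMap.smul_apply, smul_eq_mul, mul_assoc]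
    rw [integral_const_mul, h k hk, mul_zero]

/-- Riemann sums over `q`-th roots of unity are exact for trigonometric polynomials when `q` is
large. -/
theorem exists_sum_rational_rotation_eq {ψ : C(Torus, ℂ)}
    (hψ : ψ ∈ Submodule.span ℂ (Set.range (@fourier (2 * Real.pi)))) :
    ∃ q₀ : ℕ, ∀ q ≥ q₀, ∀ p : ℕ, p.Coprime q → ∀ θ : Torus,
      2 * Real.pi * ∑ k ∈ Finset.range q, ψ (θ + k • ((2 * Real.pi * p / q : ℝ) : Torus)) =
        q * ∫ x, ψ x := by
  induction hψ using Submodule.span_induction with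
  | mem f hf =>
    obtain ⟨n, rfl⟩ := hf
    -- For `q > |n|` and `n ≠ 0`, coprimality prevents `q ∣ p n`, so the geometric sum vanishes.
    refine ⟨n.natAbs + 1, fun q hq p hp θ => ?_⟩
    have hq0 : q ≠ 0 := by omega
    rw [integral_fourier_torus]
    simp only [fourier_apply_add, fourier_nsmul, fourier_rational]
    rw [← Finset.mul_sum]
    set ζ : ℂ := Complex.exp (2 * Real.pi * Complex.I / q) with hζ
    have hprim : IsPrimitiveRoot ζ q := Complex.isPrimitiveRoot_exp q hq0
    split_ifs with hn
    · subst hn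
      simp [mul_comm]
    · have h1 : ζ ^ ((p : ℤ) * n) ≠ 1 := by
        rw [Ne, hprim.zpow_eq_one_iff_dvd]
        intro hdvd
        have h2 := Int.dvd_of_dvd_mul_right_of_gcd_one hdvd
          (by rw [Int.gcd_natCast_natCast]; exact hp.symm)
        have h3 := Nat.le_of_dvd (Int.natAbs_pos.2 hn) (Int.natCast_dvd.1 h2)
        omega
      have h2 : (ζ ^ ((p : ℤ) * n)) ^ q = 1 := by
        rw [← zpow_natCast, ← zpow_mul, mul_comm, zpow_mul, zpow_natCast, hprim.pow_eq_one,
          one_zpow]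
      rw [geom_sum_eq h1, h2]
      simp
  | zero => exact ⟨0, fun q _ p _ θ => by simp⟩
  | add f g _ _ hf hg =>
    obtain ⟨q₁, h₁⟩ := hf
    obtain ⟨q₂, h₂⟩ := hg
    refine ⟨max q₁ q₂, fun q hq p hp θ => ?_⟩
    simp only [ContinuousMap.add_apply, Finset.sum_add_distrib]
    rw [integral_add (integrable_torus f.continuous) (integrable_torus g.continuous), mul_add, mul_add,
      h₁ q (le_of_max_le_left hq) p hp, h₂ q (le_of_max_le_right hq) p hp]
  | smul c f _ hf =>
    obtain ⟨q₀, h⟩ := hf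
    refine ⟨q₀, fun q hq p hp θ => ?_⟩
    simp only [ContinuousMap.smul_apply, smul_eq_mul]
    rw [← Finset.mul_sum, integral_const_mul, mul_left_comm, h q hq p hp, mul_left_comm]

/-- Riemann sums over `q`-th roots of unity are uniformly close to the mean when `q` is large. -/
theorem exists_le_sum_rational_rotation (φ : C(Torus, ℝ)) {κ : ℝ} (hκ : 0 < κ) :
    ∃ q₀ : ℕ, ∀ q ≥ q₀, ∀ p : ℕ, p.Coprime q → ∀ θ : Torus,
      q * ((∫ x, φ x) / (2 * Real.pi) - κ) ≤
        ∑ k ∈ Finset.range q, φ (θ + k • ((2 * Real.pi * p / q : ℝ) : Torus)) := by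
  -- One `κ / 2` is spent in the sum and one in the mean.
  obtain ⟨ψ, hψ, hclose⟩ := exists_trigonometric_approx φ (half_pos hκ)
  obtain ⟨q₀, hq₀⟩ := exists_sum_rational_rotation_eq hψ
  refine ⟨q₀, fun q hq p hp θ => ?_⟩
  have h := congrArg Complex.re (hq₀ q hq p hp θ)
  have hre : ∀ x, |(ψ x).re - φ x| ≤ κ / 2 := fun x => by
    refine le_trans ?_ (hclose x)
    have := Complex.abs_re_le_norm (ψ x - (φ x : ℂ))
    simpa using this
  have e1 : (2 * Real.pi * ∑ k ∈ Finset.range q,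
      ψ (θ + k • ((2 * Real.pi * p / q : ℝ) : Torus)) : ℂ).re = 2 * Real.pi *
      ∑ k ∈ Finset.range q, (ψ (θ + k • ((2 * Real.pi * p / q : ℝ) : Torus))).re := by
    rw [← Complex.re_sum, ← Complex.re_ofReal_mul]
    push_cast; rfl
  have e2 : ((q : ℂ) * ∫ x, ψ x).re = q * ∫ x, (ψ x).re := by
    rw [← Complex.ofReal_natCast, Complex.re_ofReal_mul]
    congr 1
    exact (integral_re (integrable_torus ψ.continuous)).symm
  rw [e1, e2] at h
  have h1 : ∑ k ∈ Finset.range q, ((ψ (θ + k • ((2 * Real.pi * p / q : ℝ) : Torus))).re - κ / 2) ≤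
      ∑ k ∈ Finset.range q, φ (θ + k • ((2 * Real.pi * p / q : ℝ) : Torus)) :=
    Finset.sum_le_sum fun k _ => by linarith [(abs_le.1 (hre (θ +
      k • ((2 * Real.pi * p / q : ℝ) : Torus)))).2]
  rw [Finset.sum_sub_distrib, Finset.sum_const, Finset.card_range, nsmul_eq_mul] at h1
  have h2 : ∫ x, (φ x - κ / 2) ≤ ∫ x, (ψ x).re :=
    integral_mono ((integrable_torus φ.continuous).sub (integrable_const _))
      (integrable_torus ψ.continuous).re fun x => by linarith [(abs_le.1 (hre x)).1]
  rw [integral_sub (integrable_torus φ.continuous) (integrable_const _), integral_const] at h2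
  rw [volume_real_univ_torus, smul_eq_mul] at h2
  have hpi := Real.two_pi_pos
  have h4 : (∫ x, φ x) / (2 * Real.pi) - κ / 2 ≤ (∫ x, (ψ x).re) / (2 * Real.pi) := by
    rw [le_div_iff₀ hpi, sub_mul, div_mul_cancel₀ _ hpi.ne']
    linarith
  have h5 : ∑ k ∈ Finset.range q, (ψ (θ + k • ((2 * Real.pi * p / q : ℝ) : Torus))).re =
      q * ((∫ x, (ψ x).re) / (2 * Real.pi)) := by
    field_simp
    linarith
  rw [h5] at h1
  have h6 : (q : ℝ) * ((∫ x, φ x) / (2 * Real.pi) - κ / 2) ≤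
      q * ((∫ x, (ψ x).re) / (2 * Real.pi)) := by gcongr
  linarith

/-- An open set carries a continuous bump function with almost all of its measure. -/
theorem exists_bump_torus {S : Set Torus} (hS : IsOpen S) {r : ℝ} (hr : r < volume.real S)
    (hr0 : 0 ≤ r) :
    ∃ φ : C(Torus, ℝ), (∀ x, 0 ≤ φ x) ∧ (∀ x, φ x ≤ 1) ∧ (∀ x ∉ S, φ x = 0) ∧ r < ∫ x, φ x := by
  have h : ENNReal.ofReal r < volume S := (ENNReal.ofReal_lt_iff_lt_toReal hr0
    (measure_ne_top _ _)).2 hr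
  obtain ⟨K, hKS, hK, hrK⟩ := hS.exists_lt_isCompact h
  obtain ⟨φ, h1, h0, -, h01⟩ := exists_continuous_one_zero_of_isCompact hK hS.isClosed_compl
    (Set.disjoint_compl_right_iff_subset.2 hKS)
  refine ⟨φ, fun x => (h01 x).1, fun x => (h01 x).2, fun x hx => h0 hx, ?_⟩
  have hrK' : r < volume.real K := (ENNReal.ofReal_lt_iff_lt_toReal hr0 (measure_ne_top _ _)).1 hrK
  refine hrK'.trans_le ?_
  rw [← integral_indicator_one hK.measurableSet]
  refine integral_mono ((integrable_const (1 : ℝ)).indicator hK.measurableSet)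
    (integrable_torus φ.continuous) fun x => ?_
  by_cases hx : x ∈ K
  · rw [Set.indicator_of_mem hx, h1 hx]
  · rw [Set.indicator_of_notMem hx]
    exact (h01 x).1

/-- A lower bound for trigonometric polynomials whose frequencies lie in a window of length `L`
extends to all frequencies in `Λ`, up to any prescribed loss, when `L` is large. -/
theorem exists_window_length (φ : C(Torus, ℝ)) {ε : ℝ} (hε : 0 < ε) :
    ∃ L : ℕ, 0 < L ∧ ∀ (A : ℝ) (Λ : Set ℤ),
      (∀ (j : ℤ) (s : Finset ℤ) (a : ℤ → ℂ), (∀ n ∈ s, n ∈ Λ ∧ j ≤ n ∧ n < j + L) →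
        A * ∫ x, ‖trigPoly s a x‖ ^ 2 ≤ ∫ x, φ x * ‖trigPoly s a x‖ ^ 2) →
      ∀ (s : Finset ℤ) (a : ℤ → ℂ), (∀ n ∈ s, n ∈ Λ) →
        (A - ε) * ∫ x, ‖trigPoly s a x‖ ^ 2 ≤ ∫ x, φ x * ‖trigPoly s a x‖ ^ 2 := by
  have hε3 : 0 < ε / 3 := by positivity
  have hpi := Real.two_pi_pos
  obtain ⟨ψ, hψ, hclose⟩ := exists_trigonometric_approx φ hε3
  obtain ⟨t, ht⟩ := exists_finset_integral_mul_fourier_eq_zero hψ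
  set g : ℤ → ℂ := fun k => ∫ x, ψ x * fourier k x with hg
  set M : ℝ := ∑ k ∈ t, |(k : ℝ)| * ‖g k‖ with hM
  -- Each `ε / 3` pays for one loss: replacing `φ` by `ψ` on windows, the Toeplitz averaging, and
  -- returning to `φ`. `L` depends only on `φ` and `ε`.
  obtain ⟨L, hL⟩ := exists_nat_gt (M / (2 * Real.pi * (ε / 3)))
  have hM0 : 0 ≤ M := by positivity
  have hL0 : (0 : ℝ) < L := lt_of_le_of_lt (by positivity) hL
  have hML : M ≤ 2 * Real.pi * (ε / 3) * L := by
    rw [div_lt_iff₀ (by positivity)] at hL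
    linarith
  refine ⟨L, by exact_mod_cast hL0, fun A Λ hwin s a hs => ?_⟩
  have hre : ∀ x, |(ψ x).re - φ x| ≤ ε / 3 := fun x => by
    refine le_trans ?_ (hclose x)
    have := Complex.abs_re_le_norm (ψ x - (φ x : ℂ))
    simpa using this
  have hform : ∀ s : Finset ℤ,
      |(∑ n ∈ s, ∑ m ∈ s, a n * (starRingEnd ℂ) (a m) * g (n - m)).re -
        ∫ x, φ x * ‖trigPoly s a x‖ ^ 2| ≤ ε / 3 * ∫ x, ‖trigPoly s a x‖ ^ 2 := by
    intro s
    rw [← integral_mul_norm_trigPoly_sq ψ s a]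
    have e1 : (∫ x, ψ x * ((‖trigPoly s a x‖ ^ 2 : ℝ) : ℂ)).re =
        ∫ x, (ψ x).re * ‖trigPoly s a x‖ ^ 2 := by
      have h := integral_re (𝕜 := ℂ) (μ := volume)
        (f := fun x => ψ x * ((‖trigPoly s a x‖ ^ 2 : ℝ) : ℂ)) (integrable_torus (by fun_prop))
      refine Eq.trans h.symm (integral_congr_ae (Filter.Eventually.of_forall fun x => ?_))
      exact Complex.re_mul_ofReal _ _
    rw [e1, ← integral_sub (integrable_torus (by fun_prop)) (integrable_torus (by fun_prop)),
      ← integral_const_mul]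
    refine (abs_integral_le_integral_abs).trans (integral_mono (integrable_torus (by fun_prop))
      (integrable_torus (by fun_prop)) fun x => ?_)
    simp only [← sub_mul, abs_mul, abs_pow, abs_norm]
    gcongr
    exact hre x
  have key := toeplitz_form_lower_bound g t ht L (2 * Real.pi * (A - ε / 3)) s a fun j => by
    set s' := s.filter fun n => j ≤ n ∧ n < j + L with hs'
    have h1 := hwin j s' a fun n hn => ⟨hs n (Finset.mem_filter.1 hn).1, (Finset.mem_filter.1 hn).2⟩
    have h2 := (abs_le.1 (hform s')).1
    rw [integral_norm_trigPoly_sq] at h1 h2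
    linarith
  have h3 := (abs_le.1 (hform s)).2
  rw [integral_norm_trigPoly_sq] at h3 ⊢
  have hsum : 0 ≤ ∑ n ∈ s, ‖a n‖ ^ 2 := by positivity
  have h4 : L * (2 * Real.pi * (A - 2 * (ε / 3)) * ∑ n ∈ s, ‖a n‖ ^ 2) ≤
      L * (∑ n ∈ s, ∑ m ∈ s, a n * (starRingEnd ℂ) (a m) * g (n - m)).re := by
    refine le_trans ?_ key
    have := mul_le_mul_of_nonneg_right hML hsum
    rw [← hM]
    linarith
  have h5 := le_of_mul_le_mul_left h4 hL0
  linarith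

/-- Locally, a simple quasicrystal with slope close to `p / q` is contained in a set of integers `n`
for which `p n` lies in a short interval modulo `q`. -/
theorem exists_window_residues {α a b : ℝ} {p q L N : ℕ} (hq : 0 < q)
    (hα : p / q ≤ α) (hα' : (α - p / q) * L ≤ 1 / q) (hN : q * (b - a) + 3 ≤ N) (j : ℤ) :
    ∃ t : ℤ, ∀ n ∈ simpleQuasicrystal α (Set.Ico a b), j ≤ n → n < j + L →
      ∃ i < N, ∃ m : ℤ, p * n = t + (i : ℕ) + q * m := by
  have hq' : (0 : ℝ) < q := by exact_mod_cast hq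
  -- The drift at the start of the window; across the window it varies by at most `1`. Hence `p n -
  -- q m` lies in `[q a + w - 1, q b + w)`.
  set w : ℝ := p * j - q * (α * j) with hw
  refine ⟨⌈q * a + w - 1⌉, fun n hn hjn hnL => ?_⟩
  have h1 : a ≤ Int.fract (α * n) := hn.1
  have h2 : Int.fract (α * n) < b := hn.2
  rw [Int.fract] at h1 h2
  set m := ⌊α * n⌋
  have hjn' : (0 : ℝ) ≤ n - j := by
    have : (j : ℝ) ≤ n := by exact_mod_cast hjn
    linarith
  have hnL' : (n : ℝ) - j ≤ L := by
    have : (n : ℝ) ≤ j + L := by exact_mod_cast hnL.le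
    linarith
  have he0 : 0 ≤ (α - p / q) * (n - j) := mul_nonneg (by linarith) hjn'
  have he1 : (α - p / q) * (n - j) ≤ 1 / q :=
    (mul_le_mul_of_nonneg_left hnL' (by linarith)).trans hα'
  have he0' : 0 ≤ q * ((α - p / q) * (n - j)) := by positivity
  have he1' : q * ((α - p / q) * (n - j)) ≤ 1 := by
    rw [le_div_iff₀ hq'] at he1
    linarith
  have hval : (p : ℝ) * n - q * m = q * (α * n - m) + w - q * ((α - p / q) * (n - j)) := by
    rw [hw]
    field_simp
    ring
  have h1' := mul_le_mul_of_nonneg_left h1 hq'.le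
  have h2' := mul_lt_mul_of_pos_left h2 hq'
  have hi0 : ⌈q * a + w - 1⌉ ≤ p * n - q * m := by
    rw [Int.ceil_le]
    push_cast
    linarith
  have hc := Int.le_ceil (q * a + w - 1)
  have hi1 : p * n - q * m - ⌈q * a + w - 1⌉ < N := by
    have : (p : ℝ) * n - q * m - ⌈q * a + w - 1⌉ < N := by linarith
    exact_mod_cast this
  exact ⟨(p * n - q * m - ⌈q * a + w - 1⌉).toNat, by omega, m, by
    rw [Int.toNat_of_nonneg (by omega)]; ring⟩

/-! ### Choice of the slope -/

/-- Slopes of simple quasicrystals of density at most `τ < |S| / 2π` that form Riesz sequences over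
the open set `S` are dense in `(0, 1)`. -/
theorem exists_irrational_isRieszSequence {S : Set Torus} (hS : IsOpen S) {τ : ℝ} (hτ0 : 0 ≤ τ)
    (hτ : 2 * Real.pi * τ < volume.real S) {u v : ℝ} (hu : 0 ≤ u) (huv : u < v) (hv : v ≤ 1) :
    ∃ α, Irrational α ∧ u < α ∧ α < v ∧ ∀ a b, b - a ≤ τ →
      IsRieszSequence (expSystem S (simpleQuasicrystal α (Set.Ico a b))) := by
  have hpi := Real.two_pi_pos
  obtain ⟨φ, hφ0, hφ1, hφS, hφτ⟩ := exists_bump_torus hS hτ (by positivity)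
  -- The mean of `φ` is `τ + 3κ`: one `κ` is lost in the Riemann sum, one on points where `φ < κ`,
  -- and one remains as slack.
  set κ : ℝ := ((∫ x, φ x) / (2 * Real.pi) - τ) / 3 with hκdef
  have hκ : 0 < κ := by
    have : τ < (∫ x, φ x) / (2 * Real.pi) := by rw [lt_div_iff₀ hpi]; linarith
    rw [hκdef]; linarith
  obtain ⟨q₀, hq₀⟩ := exists_le_sum_rational_rotation φ hκ
  -- `q κ ≥ 4` covers the `3` spare residues required by `exists_window_residues` and the `1` lost
  -- in the floor defining `N`.
  obtain ⟨q₁, hq₁⟩ := exists_nat_gt (4 / κ)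
  obtain ⟨q₂, hq₂⟩ := exists_nat_gt (1 / (v - u))
  obtain ⟨q, hqle, hqp⟩ := Nat.exists_infinite_primes (max q₀ (max q₁ q₂))
  have hq0 : (0 : ℝ) < q := by exact_mod_cast hqp.pos
  have hqκ : 4 ≤ q * κ := by
    have h1 : (q₁ : ℝ) ≤ q := by exact_mod_cast (le_max_of_le_right (le_max_left _ _)).trans hqle
    rw [div_lt_iff₀ hκ] at hq₁
    exact hq₁.le.trans (by gcongr)
  have hquv : 1 < q * (v - u) := by
    have h1 : (q₂ : ℝ) ≤ q := by exact_mod_cast (le_max_of_le_right (le_max_right _ _)).trans hqle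
    rw [div_lt_iff₀ (by linarith)] at hq₂
    exact hq₂.trans_le (mul_le_mul_of_nonneg_right h1 (by linarith))
  set p : ℕ := ⌊u * q⌋₊ + 1 with hp
  have hpu : u * q < p := by rw [hp]; push_cast; exact Nat.lt_floor_add_one _
  have hpv : (p : ℝ) < v * q := by
    have := Nat.floor_le (a := u * q) (by positivity)
    rw [hp]; push_cast; linarith
  have hpq : p < q := by
    have : (p : ℝ) < q := hpv.trans_le (mul_le_of_le_one_left hq0.le hv)
    exact_mod_cast this
  have hcop : p.Coprime q := (Nat.coprime_of_lt_prime (by omega) hpq hqp).symm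
  set N : ℕ := ⌊q * (τ + κ)⌋₊ with hN
  have hNle : (N : ℝ) ≤ q * (τ + κ) := Nat.floor_le (by positivity)
  have hNge : q * τ + 3 ≤ N := by
    have := Nat.lt_floor_add_one (q * (τ + κ))
    rw [← hN] at this
    linarith
  have hcount : ∀ θ : Torus, N ≤ ((Finset.range q).filter fun k =>
      κ ≤ φ (θ + k • ((2 * Real.pi * p / q : ℝ) : Torus))).card := by
    intro θ
    have h1 := hq₀ q ((le_max_left _ _).trans hqle) p hcop θ
    set K := (Finset.range q).filter fun k =>
      κ ≤ φ (θ + k • ((2 * Real.pi * p / q : ℝ) : Torus)) with hK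
    have h2 : ∑ k ∈ Finset.range q, φ (θ + k • ((2 * Real.pi * p / q : ℝ) : Torus)) ≤
        ∑ k ∈ Finset.range q,
          ((if κ ≤ φ (θ + k • ((2 * Real.pi * p / q : ℝ) : Torus)) then 1 else 0) + κ) := by
      refine Finset.sum_le_sum fun k _ => ?_
      split_ifs with h
      · linarith [hφ1 (θ + k • ((2 * Real.pi * p / q : ℝ) : Torus))]
      · linarith
    rw [Finset.sum_add_distrib, Finset.sum_boole, ← hK, Finset.sum_const, Finset.card_range,
      nsmul_eq_mul] at h2
    have h3 : (∫ x, φ x) / (2 * Real.pi) = τ + 3 * κ := by rw [hκdef]; ring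
    rw [h3] at h1
    have h4 : (N : ℝ) ≤ K.card := by linarith
    exact_mod_cast h4
  obtain ⟨A, hA0, hA⟩ := exists_sampling_constant (Complex.isPrimitiveRoot_exp q hqp.ne_zero) N
  have hκA : 0 < κ * A := mul_pos hκ hA0
  obtain ⟨L, hL0, hL⟩ := exists_window_length φ (half_pos hκA)
  have hL0' : (0 : ℝ) < L := by exact_mod_cast hL0
  -- `A` depends on `q` and `L` on `A`; only now is the admissible distance from `α` to `p / q`
  -- known.
  have hpqv : (p : ℝ) / q < min v (p / q + 1 / (q * L)) := by
    refine lt_min ((div_lt_iff₀ hq0).2 hpv) ?_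
    have : (0 : ℝ) < 1 / (q * L) := by positivity
    linarith
  obtain ⟨α, hαi, hα1, hα2⟩ := exists_irrational_btwn hpqv
  rw [lt_min_iff] at hα2
  refine ⟨α, hαi, ((lt_div_iff₀ hq0).2 hpu).trans hα1, hα2.1, fun a b hab => ?_⟩
  have hα3 : (α - p / q) * L ≤ 1 / q := by
    have h1 : α - p / q ≤ 1 / (q * L) := by linarith [hα2.2]
    calc (α - p / q) * L ≤ 1 / (q * L) * L := by gcongr
      _ = 1 / q := by field_simp
  have hNab : q * (b - a) + 3 ≤ N := by
    have : q * (b - a) ≤ q * τ := by gcongr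
    linarith
  refine isRieszSequence_expSystem (A := κ * A / 2 * (2 * Real.pi)) (by positivity)
    fun s c hs => ?_
  have h1 := hL (κ * A) (simpleQuasicrystal α (Set.Ico a b)) (fun j s c hs => by
    obtain ⟨t, ht⟩ := exists_window_residues hqp.pos hα1.le hα3 hNab j
    exact trigPoly_weighted_lower_bound hφ0 hqp.ne_zero hκ.le hA hcount c (t := t)
      fun n hn => ht n (hs n hn).1 (hs n hn).2.1 (hs n hn).2.2) s c hs
  rw [integral_norm_trigPoly_sq] at h1
  calc _ = (κ * A - κ * A / 2) * (2 * Real.pi * ∑ n ∈ s, ‖c n‖ ^ 2) := by ring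
    _ ≤ _ := h1
    _ = ∫ x in S, φ x * ‖trigPoly s c x‖ ^ 2 :=
        (setIntegral_eq_integral_of_forall_compl_eq_zero fun x hx => by
          rw [hφS x hx, zero_mul]).symm
    _ ≤ _ := integral_mono (integrable_torus (by fun_prop)).integrableOn
        (integrable_torus (by fun_prop)).integrableOn fun x =>
          mul_le_of_le_one_left (by positivity) (hφ1 x)

theorem isRieszSequence_expSystem_of_measure_compl_eq_zero {S : Set Torus}
    (hS : volume Sᶜ = 0) (Λ : Set ℤ) : IsRieszSequence (expSystem S Λ) := by
  refine isRieszSequence_expSystem Real.two_pi_pos fun s a _ => ?_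
  have h : (volume : Measure Torus).restrict S = volume :=
    Measure.restrict_eq_self_of_ae_mem hS
  rw [h, integral_norm_trigPoly_sq]

theorem isSimpleQuasicrystal_Ico_zero {α b : ℝ} (hα : Irrational α) (hb0 : 0 < b) (hb : b ≤ 1) :
    IsSimpleQuasicrystal (simpleQuasicrystal α (Set.Ico 0 b)) :=
  ⟨α, 0, b, hα, le_rfl, hb0, hb, rfl⟩

theorem volume_real_torus_le (S : Set Torus) : volume.real S ≤ 2 * Real.pi :=
  (measureReal_mono (Set.subset_univ S)).trans_eq volume_real_univ_torus

/-! ### Proof of the two assertions -/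

/-- Every nonempty open set `S` admits a simple quasicrystal with gaps `1` and `d ≤ 10π / |S|` whose
exponentials form a Riesz sequence over `S`. -/
theorem exists_quasicrystal_two_gaps {S : Set Torus} (hS : IsOpen S) (hne : S.Nonempty) :
    ∃ (Λ : Set ℤ) (d : ℕ), IsSimpleQuasicrystal Λ ∧ IsSyndetic Λ ∧ 1 < d ∧
      consecutiveGaps Λ = {1, (d : ℤ)} ∧ (d : ℝ) ≤ 10 * Real.pi / volume.real S ∧
      IsRieszSequence (expSystem S Λ) := by
  have hpi := Real.two_pi_pos
  have hpos : 0 < volume.real S :=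
    ENNReal.toReal_pos (hS.measure_pos volume hne).ne' (measure_ne_top _ _)
  have hle := volume_real_torus_le S
  set σ : ℝ := volume.real S / (2 * Real.pi) with hσ
  have hσ0 : 0 < σ := by positivity
  have hσ1 : σ ≤ 1 := (div_le_one hpi).2 hle
  have hSσ : volume.real S = 2 * Real.pi * σ := by rw [hσ]; field_simp
  set d : ℕ := ⌈4 / σ⌉₊ with hd
  have hd1 : 4 / σ ≤ d := Nat.le_ceil _
  have hd2 : (d : ℝ) < 4 / σ + 1 := Nat.ceil_lt_add_one (by positivity)
  have hσinv : 1 ≤ 1 / σ := by rw [le_div_iff₀ hσ0]; linarith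
  have h4 : 4 / σ = 4 * (1 / σ) := by ring
  have hd4 : (4 : ℝ) ≤ d := by linarith
  have hdσ : 4 ≤ d * σ := by rwa [div_le_iff₀ hσ0] at hd1
  -- `dα < 1` gives the gaps `1` and `d`, while `(d + 1)α > 1` makes the interval shorter than `2α ≤
  -- σ / 2`.
  obtain ⟨α, hα, hα1, hα2, hR⟩ := exists_irrational_isRieszSequence hS (τ := σ / 2) (by positivity)
    (by rw [hSσ]; nlinarith) (u := 1 / (d + 1)) (v := 1 / d) (by positivity)
    (one_div_lt_one_div_of_lt (by linarith) (by linarith))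
    (by rw [div_le_one (by linarith)]; linarith)
  have hα0 : 0 < α := lt_trans (by positivity) hα1
  rw [lt_div_iff₀ (by linarith)] at hα2
  rw [div_lt_iff₀ (by linarith)] at hα1
  have hdgt : 1 < d := by
    have : (1 : ℝ) < d := by linarith
    exact_mod_cast this
  obtain ⟨h1, h2⟩ := simpleQuasicrystal_two_gaps hα0 hdgt (by linarith)
  refine ⟨_, d, isSimpleQuasicrystal_Ico_zero hα ?_ ?_, h1, hdgt, h2, ?_, hR _ _ ?_⟩
  · linarith
  · nlinarith
  · have : 10 * Real.pi / volume.real S = 5 * (1 / σ) := by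
      rw [hSσ]; field_simp; norm_num
    rw [this]; linarith
  · have hα3 : α ≤ σ / 4 := by
      by_contra! h
      nlinarith
    linarith

theorem one_le_einfsep_int (Λ : Set ℤ) : 1 ≤ Λ.einfsep := by
  refine Set.le_einfsep fun x _ y _ hxy => ?_
  rw [edist_dist, Int.dist_eq, ← ENNReal.ofReal_one]
  refine ENNReal.ofReal_le_ofReal ?_
  exact_mod_cast Int.one_le_abs (sub_ne_zero.2 hxy)

theorem theorem2p5 :
    ∃ C c : ℝ, 0 < C ∧ 0 < c ∧
      ∀ S : Set Torus, IsOpen S → S.Nonempty →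
        (∃ (Λ : Set ℤ) (d : ℕ),
          IsSimpleQuasicrystal Λ ∧
          IsSyndetic Λ ∧ 1 < d ∧ consecutiveGaps Λ = {1, (d : ℤ)} ∧
          (d : ℝ) ≤ C / volume.real S ∧
          IsRieszSequence (expSystem S Λ)) ∧
        (1 / 2 < volume.real S / (2 * Real.pi) →
          ∃ (Λ : Set ℤ) (d : ℕ),
            -- a simple quasicrystal whenever `Sᶜ` is not a null set; if `Sᶜ` is a null set, then
            -- the bound on `einfsep` below says that `Λᶜ` has at most one element
            (volume Sᶜ ≠ 0 → IsSimpleQuasicrystal Λ) ∧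
            IsSyndetic Λ ∧ 1 < d ∧ consecutiveGaps Λ = {1, (d : ℤ)} ∧
            (d : ℝ) ≤ C / volume.real S ∧
            IsRieszSequence (expSystem S Λ) ∧
            0 < Λᶜ.einfsep ∧
            ENNReal.ofReal c / volume Sᶜ ≤ Λᶜ.einfsep) := by
  have hpi := Real.two_pi_pos
  have hpi3 := Real.pi_gt_three
  refine ⟨10 * Real.pi, 1 / 2, by positivity, by norm_num, fun S hS hne =>
    ⟨exists_quasicrystal_two_gaps hS hne, fun _ => ?_⟩⟩
  have hpos : 0 < volume.real S :=
    ENNReal.toReal_pos (hS.measure_pos volume hne).ne' (measure_ne_top _ _)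
  have hsep0 : ∀ Λ : Set ℤ, 0 < Λᶜ.einfsep := fun Λ => zero_lt_one.trans_le (one_le_einfsep_int _)
  have hd2 : ((2 : ℕ) : ℝ) ≤ 10 * Real.pi / volume.real S := by
    rw [le_div_iff₀ hpos]
    push_cast
    linarith [volume_real_torus_le S]
  rcases eq_or_ne (volume Sᶜ) 0 with h0 | h0
  · exact ⟨{0}ᶜ, 2, fun h => absurd h0 h, isSyndetic_compl_zero, by norm_num,
      consecutiveGaps_compl_zero, hd2, isRieszSequence_expSystem_of_measure_compl_eq_zero h0 _,
      hsep0 _, by rw [compl_compl, Set.einfsep_singleton]; exact le_top⟩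
  · have hc0 : 0 < volume.real Sᶜ := ENNReal.toReal_pos h0 (measure_ne_top _ _)
    have hc : volume Sᶜ = ENNReal.ofReal (volume.real Sᶜ) := by simp
    -- If `|Sᶜ| ≥ 1/2`, the required separation is at most `1`, which holds in any set of integers.
    rcases le_or_gt (1 / 2) (volume.real Sᶜ) with hbig | hsmall
    · obtain ⟨Λ, d, h1, h2, h3, h4, h5, h6⟩ := exists_quasicrystal_two_gaps hS hne
      refine ⟨Λ, d, fun _ => h1, h2, h3, h4, h5, h6, hsep0 _, le_trans ?_ (one_le_einfsep_int _)⟩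
      rw [hc, ← ENNReal.ofReal_div_of_pos hc0, ENNReal.ofReal_le_one]
      exact (div_le_one hc0).2 hbig
    · set δ : ℝ := volume.real Sᶜ / (2 * Real.pi) with hδ
      have hδ0 : 0 < δ := by positivity
      have hcδ : volume.real Sᶜ = 2 * Real.pi * δ := by rw [hδ]; field_simp
      have hδ1 : δ < 1 / 12 := by
        rw [hδ, div_lt_iff₀ hpi]; linarith
      have hadd : volume.real S = 2 * Real.pi * (1 - δ) := by
        have h1 : volume.real S + volume.real Sᶜ = (volume : Measure Torus).real Set.univ :=
          measureReal_add_measureReal_compl hS.measurableSet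
        rw [volume_real_univ_torus, hcδ] at h1
        linarith
      -- The interval length `1 - α < 1 - 2δ` stays below `|S|/2π = 1 - δ`. From `α < 3δ` and `δ <
      -- 1/12` the separation is at least `1/(3δ) - 1 ≥ 1/(4πδ)`, which is `(1/2)/|Sᶜ|`.
      obtain ⟨α, hα, hα1, hα2, hR⟩ := exists_irrational_isRieszSequence hS (τ := 1 - 2 * δ)
        (by linarith) (by rw [hadd]; nlinarith) (u := 2 * δ) (v := 3 * δ) (by positivity)
        (by linarith) (by linarith)
      have hα0 : 0 < α := lt_trans (by positivity) hα1
      obtain ⟨h1, h2⟩ := simpleQuasicrystal_two_gaps hα0 one_lt_two (by push_cast; linarith)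
      have hb : (1 : ℝ) - (((2 : ℕ) : ℝ) - 1) * α = 1 - α := by push_cast; ring
      rw [hb] at h1 h2
      refine ⟨_, 2, fun _ => isSimpleQuasicrystal_Ico_zero hα (by linarith) (by linarith), h1,
        one_lt_two, h2, hd2, hR _ _ (by linarith), hsep0 _, Set.le_einfsep fun n hn m hm hnm => ?_⟩
      rw [hc, ← ENNReal.ofReal_div_of_pos hc0, edist_dist, Int.dist_eq]
      refine ENNReal.ofReal_le_ofReal (le_trans ?_
        (le_of_le_of_eq (abs_sub_of_notMem_simpleQuasicrystal hα0 hn hm hnm) rfl))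
      rw [hcδ, div_sub_one hα0.ne', div_le_div_iff₀ (by positivity) hα0]
      nlinarith
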